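/- There are $n$ players and $k$ arms. A stochastic bandit $\mathbf D=(D_1,\dots,D_k)$ assigns to each arm $i$ a reward distribution $D_i$ supported on $[-1,1]$ with mean $\mu_i$, such that the arm with the highest mean $\mu^*=\max_i\mu_i$ is unique. A policy maps each history of all players' actions and rewards in the first $t$ rounds to a distribution over the arms, from which the player draws her arm in round $t+1$; pulling arm $i$ yields a reward drawn from $D_i$. In each round, the players' random choices and rewards are drawn independently of each other given the history. The policy of player $p$ is self-reliant if it depends only on $p$'s own past actions and rewards. For a policy profile $\mathbf f=(f_1,\dots,f_n)$, let $R_p^T(\mathbf D,\mathbf f)=T\mu^*-\sum_{t=1}^T\mathbb E[r_p^t]$ be the regret of player $p$, where $r_p^t$ is the reward of $p$ in round $t$, and let $N_{p,i}^T(\mathbf D,\mathbf f)$ be the number of times $p$ pulls arm $i$ in the first $T$ rounds. Theorem. Let $\varepsilon>0$, let $\mathbf f$ be a policy profile and let $p$ be a player whose policy $f_p$ is self-reliant. Suppose that for every $k$-arm stochastic bandit $\mathbf D$, $R_p^T(\mathbf D,\mathbf f)=O(T^{1-\varepsilon})$ as $T\to\infty$. Then for every $k$-arm stochastic bandit $\mathbf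 D$ with $\mu^*<1$ and every arm $i\in[k]$, $\mathbb E[N_{p,i}^T(\mathbf D,\mathbf f)]=\Omega(\log T)$ as $T\to\infty$. The implied constants may depend on $\mathbf D$ (and on $\mathbf f$, $\varepsilon$, $p$, $i$). -/

import Mathlib

open MeasureTheory ProbabilityTheory Filter Asymptotics

noncomputable section

/-- A stochastic bandit with `k` arms: every arm has a reward distribution supported on `[-1, 1]`,
and the arm with the highest mean reward is unique. -/
structure StochasticBandit (k : ℕ) where
  /-- the reward distribution of each arm -/
  reward : Fin k → Measure ℝ
  isProb : ∀ i, IsProbabilityMeasure (reward i)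
  support : ∀ i, ∀ᵐ x ∂(reward i), x ∈ Set.Icc (-1 : ℝ) 1
  unique_best : ∃ i, ∀ j, j ≠ i → ∫ x, x ∂(reward j) < ∫ x, x ∂(reward i)

namespace StochasticBandit

variable {k : ℕ}

/-- The mean reward of arm `i`. -/
def mean (D : StochasticBandit k) (i : Fin k) : ℝ := ∫ x, x ∂(D.reward i)

/-- The highest mean reward (a supremum over finitely many arms; there is at least one arm). -/
def bestMean (D : StochasticBandit k) : ℝ := ⨆ i, D.mean i

/-- The reward distributions as a kernel from arms to rewards. -/
def rewardKernel (D : StochasticBandit k) : Kernel (Fin k) ℝ where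
  toFun := D.reward
  measurable' := measurable_of_finite _

instance (D : StochasticBandit k) : IsMarkovKernel D.rewardKernel := ⟨D.isProb⟩

end StochasticBandit

/-- Histories of the first `t` rounds with `n` players and `k` arms: `h s p` is the pair consisting
of the arm pulled and the reward received by player `p` in round `s + 1`. -/
abbrev History (n k t : ℕ) : Type := Fin t → Fin n → Fin k × ℝ

/-- A (possibly randomized) policy maps each history of any length `t` to a distribution over the
arms, measurably in the history; the arm of round `t + 1` is drawn from it. -/
structure Policy (n k : ℕ) where
  choice : (t : ℕ) → Kernel (History n k t) (Fin k)
  isMarkov : ∀ t, IsMarkovKernel (choice t)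

attribute [instance] Policy.isMarkov

/-- The policy `f` of player `p` is self-reliant: it depends only on `p`'s own actions and rewards. -/
def Policy.SelfReliant {n k : ℕ} (f : Policy n k) (p : Fin n) : Prop :=
  ∀ (t : ℕ) (h h' : History n k t), (∀ s, h s p = h' s p) → f.choice t h = f.choice t h'

section Play

variable {n k : ℕ} (D : StochasticBandit k) (F : Fin n → Policy n k)

theorem measurable_roundLaw (t : ℕ) : Measurable fun h : History n k t =>
    Measure.pi fun p => (F p).choice t h ⊗ₘ D.rewardKernel := by
  refine Measurable.measure_of_isPiSystem_of_isProbabilityMeasure generateFrom_pi.symm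
    isPiSystem_pi ?_
  rintro _ ⟨s, hs, rfl⟩
  simp only [Measure.pi_pi]
  refine Finset.measurable_prod _ fun p _ => ?_
  have hp : MeasurableSet (s p) := hs p (Set.mem_univ p)
  simp only [Measure.compProd_apply hp]
  exact (Measure.measurable_lintegral (Kernel.measurable_kernel_prodMk_left hp)).comp
    ((F p).choice t).measurable

/-- Given the history of the first `t` rounds, in round `t + 1` every player draws an arm from her
policy and then a reward from that arm's distribution, independently of the other players. -/
def roundKernel (t : ℕ) : Kernel (History n k t) (Fin n → Fin k × ℝ) where
  toFun h := Measure.pi fun p => (F p).choice t h ⊗ₘ D.rewardKernel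
  measurable' := measurable_roundLaw D F t

instance (t : ℕ) : IsMarkovKernel (roundKernel D F t) :=
  ⟨fun h => inferInstanceAs (IsProbabilityMeasure
    (Measure.pi fun p => (F p).choice t h ⊗ₘ D.rewardKernel))⟩

/-- Appending one round to a history. -/
def History.extend {t : ℕ} (x : History n k t × (Fin n → Fin k × ℝ)) : History n k (t + 1) :=
  Fin.snoc (α := fun _ => Fin n → Fin k × ℝ) x.1 x.2

theorem History.measurable_extend {t : ℕ} :
    Measurable (History.extend : History n k t × (Fin n → Fin k × ℝ) → History n k (t + 1)) := by
  refine measurable_pi_iff.2 fun s => ?_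
  refine Fin.lastCases ?_ (fun s => ?_) s
  · simpa [History.extend] using measurable_snd
  · simp only [History.extend, Fin.snoc_castSucc]
    exact (measurable_pi_apply s).comp measurable_fst

/-- The distribution, determined by the bandit `D` and the policy profile `F`, of the history of
the first `T` rounds. -/
def historyLaw : (T : ℕ) → Measure (History n k T)
  | 0 => Measure.dirac Fin.elim0
  | t + 1 => (historyLaw t ⊗ₘ roundKernel D F t).map History.extend

instance historyLaw.isProbabilityMeasure (T : ℕ) : IsProbabilityMeasure (historyLaw D F T) := by
  induction T with
  | zero => exact inferInstanceAs (IsProbabilityMeasure (Measure.dirac _))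
  | succ t ih =>
    exact Measure.isProbabilityMeasure_map
      (μ := historyLaw D F t ⊗ₘ roundKernel D F t) History.measurable_extend.aemeasurable

/-- The regret of player `p` at time `T`: `T μ* - ∑ₜ E[rₚᵗ]`. -/
def regret (p : Fin n) (T : ℕ) : ℝ :=
  (T : ℝ) * D.bestMean - ∑ t : Fin T, ∫ h, (h t p).2 ∂(historyLaw D F T)

/-- The number of times that player `p` pulled arm `i` in the history `h`. -/
def sampleCount {T : ℕ} (h : History n k T) (p : Fin n) (i : Fin k) : ℕ :=
  (Finset.univ.filter fun t : Fin T => (h t p).1 = i).card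

/-- The expected number of times that player `p` pulls arm `i` in the first `T` rounds. -/
def expectedSampleCount (p : Fin n) (i : Fin k) (T : ℕ) : ℝ :=
  ∫ h, (sampleCount h p i : ℝ) ∂(historyLaw D F T)

end Play

end

open scoped ENNReal

/-! Under any bandit whose best arm is `i`, small regret forces player `p` to pull `i` most of the
time; a self-reliant player can tell `D` from such a bandit `D'` only by pulling `i`. Since `μ* <
1`, `exists_boost` makes `i` best by mixing its reward law with a point mass at 1. The mixture
dominates a fixed multiple of the old law, so one pull of `i` changes likelihoods by a factor of at
most `c`.

Under `D'`, `gap_mul_le_regret` and Markov's inequality give `P'(N ≤ m) = O(T^(-ε))` for `m ≤ T/2`.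
By `measureReal_sampleCount_le`, `P(N ≤ m) ≤ c^m P'(N ≤ m)`. With `m = a log T` and `c^m = T^(ε/2)`
the right side tends to 0, so eventually `E[N] ≥ m/2`. A one-sided density bound suffices; no
relative entropy is needed. -/

theorem StochasticBandit.mean_le_bestMean {k : ℕ} (D : StochasticBandit k) (i : Fin k) :
    D.mean i ≤ D.bestMean :=
  le_ciSup (Set.finite_range D.mean).bddAbove i

/-! ### One-round recursion for the history law, and the own history of a player -/

section Play

variable {n k : ℕ}

theorem lintegral_historyLaw_succ (D : StochasticBandit k) (F : Fin n → Policy n k) (t : ℕ)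
    {φ : History n k (t + 1) → ℝ≥0∞} (hφ : Measurable φ) :
    ∫⁻ h, φ h ∂(historyLaw D F (t + 1)) =
      ∫⁻ h, ∫⁻ x, φ (History.extend (h, x)) ∂(roundKernel D F t h) ∂(historyLaw D F t) := by
  rw [historyLaw, lintegral_map hφ History.measurable_extend]
  exact Measure.lintegral_compProd (hφ.comp History.measurable_extend)

theorem lintegral_roundKernel_apply (D : StochasticBandit k) (F : Fin n → Policy n k) (p : Fin n)
    {t : ℕ} (h : History n k t) {φ : Fin k × ℝ → ℝ≥0∞} (hφ : Measurable φ) :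
    ∫⁻ x, φ (x p) ∂(roundKernel D F t h) =
      ∫⁻ a, ∫⁻ r, φ (a, r) ∂(D.reward a) ∂((F p).choice t h) := by
  have hp := (measurePreserving_eval
    (fun q => (F q).choice t h ⊗ₘ D.rewardKernel) p).lintegral_comp hφ
  exact hp.trans (Measure.lintegral_compProd hφ)

/-- The actions and rewards of player `p` in the history `h`. -/
def History.own {t : ℕ} (p : Fin n) (h : History n k t) : Fin t → Fin k × ℝ := fun s => h s p

theorem History.measurable_own {t : ℕ} (p : Fin n) :
    Measurable (History.own p : History n k t → Fin t → Fin k × ℝ) :=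
  measurable_pi_iff.2 fun s => (measurable_pi_apply p).comp (measurable_pi_apply s)

theorem measurable_snoc_own {t : ℕ} : Measurable fun y : (Fin t → Fin k × ℝ) × (Fin k × ℝ) =>
    (Fin.snoc (α := fun _ => Fin k × ℝ) y.1 y.2 : Fin (t + 1) → Fin k × ℝ) := by
  refine measurable_pi_iff.2 fun s => ?_
  refine Fin.lastCases ?_ (fun s => ?_) s
  · simpa using measurable_snd
  · simp only [Fin.snoc_castSucc]
    exact (measurable_pi_apply s).comp measurable_fst

theorem History.own_extend {t : ℕ} (p : Fin n) (h : History n k t) (x : Fin n → Fin k × ℝ) :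
    History.own p (History.extend (h, x)) =
      Fin.snoc (α := fun _ => Fin k × ℝ) (History.own p h) (x p) := by
  funext s
  refine Fin.lastCases ?_ (fun s => ?_) s
  · simp [History.own, History.extend]
  · simp [History.own, History.extend]

/-- The number of pulls of arm `i` in a sequence of actions and rewards of one player. -/
def pullCount {t : ℕ} (i : Fin k) (y : Fin t → Fin k × ℝ) : ℕ :=
  (Finset.univ.filter fun s => (y s).1 = i).card

theorem pullCount_eq_sum {t : ℕ} (i : Fin k) (y : Fin t → Fin k × ℝ) :
    pullCount i y = ∑ s, if (y s).1 = i then 1 else 0 := by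
  simp [pullCount]

theorem pullCount_snoc {t : ℕ} (i : Fin k) (y : Fin t → Fin k × ℝ) (z : Fin k × ℝ) :
    pullCount i (Fin.snoc (α := fun _ => Fin k × ℝ) y z) =
      pullCount i y + if z.1 = i then 1 else 0 := by
  simp only [pullCount_eq_sum, Fin.sum_univ_castSucc, Fin.snoc_castSucc, Fin.snoc_last]

theorem measurable_pullCount {t : ℕ} (i : Fin k) :
    Measurable (pullCount i : (Fin t → Fin k × ℝ) → ℕ) := by
  have : (pullCount i : (Fin t → Fin k × ℝ) → ℕ) =
      fun y => ∑ s, if (y s).1 = i then 1 else 0 := funext (pullCount_eq_sum i)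
  rw [this]
  refine Finset.measurable_fun_sum _ fun s _ => ?_
  exact (measurable_of_finite fun a : Fin k => if a = i then 1 else 0).comp
    (measurable_fst.comp (measurable_pi_apply s))

/-! ### Change of measure for a self-reliant player -/

/-- Change of measure: if the reward distributions of `D` and `D'` agree up to a factor `c` at
arm `i`, then the laws of the own history of a self-reliant player agree up to a factor `c` per
pull of arm `i`. -/
theorem lintegral_own_le_of_selfReliant {D D' : StochasticBandit k} (F : Fin n → Policy n k)
    {p : Fin n} (hself : (F p).SelfReliant p) {i : Fin k} {c : ℝ≥0∞}
    (hc : ∀ (a : Fin k) (f : ℝ → ℝ≥0∞), ∫⁻ r, f r ∂(D.reward a) ≤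
      c ^ (if a = i then 1 else 0) * ∫⁻ r, f r ∂(D'.reward a)) (T : ℕ) :
    ∀ ψ : (Fin T → Fin k × ℝ) → ℝ≥0∞, Measurable ψ →
      ∫⁻ h, ψ (History.own p h) ∂(historyLaw D F T) ≤
        ∫⁻ h, c ^ pullCount i (History.own p h) * ψ (History.own p h) ∂(historyLaw D' F T) := by
  induction T with
  | zero =>
    intro ψ hψ
    refine le_of_eq ?_
    simp [historyLaw, pullCount]
  | succ t ih =>
    intro ψ hψ
    have hstep : ∀ (E : StochasticBandit k) (φ : (Fin (t + 1) → Fin k × ℝ) → ℝ≥0∞),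
        Measurable φ → ∫⁻ h, φ (History.own p h) ∂(historyLaw E F (t + 1)) =
          ∫⁻ h, ∫⁻ a, ∫⁻ r, φ (Fin.snoc (α := fun _ => Fin k × ℝ) (History.own p h) (a, r))
            ∂(E.reward a) ∂((F p).choice t h) ∂(historyLaw E F t) := by
      intro E φ hφ
      refine (lintegral_historyLaw_succ E F t (hφ.comp (History.measurable_own p))).trans
        (lintegral_congr fun h => ?_)
      simp only [Function.comp_apply]
      simp only [History.own_extend]
      exact lintegral_roundKernel_apply E F p h (φ := fun z =>
        φ (Fin.snoc (α := fun _ => Fin k × ℝ) (History.own p h) z))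
        (hφ.comp (measurable_snoc_own.comp (by fun_prop :
          Measurable fun z : Fin k × ℝ => (History.own p h, z))))
    -- Self-reliance enters here. Assigning `p`'s own history to every player gives a full history
    -- with the same choice law for `p`, so that law is a kernel `κ` on own histories.
    let lift : (Fin t → Fin k × ℝ) → History n k t := fun y s _ => y s
    have hlift : Measurable lift := measurable_pi_iff.2 fun s => measurable_pi_iff.2 fun _ =>
      measurable_pi_apply s
    have hchoice : ∀ h : History n k t,
        (F p).choice t h = (F p).choice t (lift (History.own p h)) :=
      fun h => hself t _ _ fun s => rfl
    let κ : Kernel (Fin t → Fin k × ℝ) (Fin k) := ((F p).choice t).comap lift hlift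
    have hκ : ∀ h : History n k t, (F p).choice t h = κ (History.own p h) := fun h => by
      rw [hchoice h]; rfl
    -- `Ψ` integrates out the last round under `D'`, paying its factor `c` in advance. It depends on
    -- the own history alone, so the induction hypothesis applies; `pullCount_snoc` later merges the
    -- two powers of `c`.
    let Ψ : (Fin t → Fin k × ℝ) → ℝ≥0∞ := fun y => ∫⁻ a, c ^ (if a = i then 1 else 0) *
      ∫⁻ r, ψ (Fin.snoc (α := fun _ => Fin k × ℝ) y (a, r)) ∂(D'.reward a) ∂(κ y)
    have hinner : Measurable fun z : (Fin t → Fin k × ℝ) × Fin k =>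
        ∫⁻ r, ψ (Fin.snoc (α := fun _ => Fin k × ℝ) z.1 (z.2, r)) ∂(D'.reward z.2) := by
      have hm : Measurable fun w : ((Fin t → Fin k × ℝ) × Fin k) × ℝ =>
          ψ (Fin.snoc (α := fun _ => Fin k × ℝ) w.1.1 (w.1.2, w.2)) :=
        hψ.comp (measurable_snoc_own.comp (by fun_prop :
          Measurable fun w : ((Fin t → Fin k × ℝ) × Fin k) × ℝ => (w.1.1, (w.1.2, w.2))))
      exact Measurable.lintegral_kernel_prod_right'
        (κ := D'.rewardKernel.comap (Prod.snd : (Fin t → Fin k × ℝ) × Fin k → Fin k)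
          measurable_snd) hm
    have hΨ : Measurable Ψ := by
      refine Measurable.lintegral_kernel_prod_right' (κ := κ)
        (f := fun z : (Fin t → Fin k × ℝ) × Fin k => c ^ (if z.2 = i then 1 else 0) *
          ∫⁻ r, ψ (Fin.snoc (α := fun _ => Fin k × ℝ) z.1 (z.2, r)) ∂(D'.reward z.2)) ?_
      exact ((measurable_of_finite fun a : Fin k =>
        c ^ (if a = i then 1 else 0)).comp measurable_snd).mul hinner
    calc ∫⁻ h, ψ (History.own p h) ∂(historyLaw D F (t + 1))
        = ∫⁻ h, ∫⁻ a, ∫⁻ r, ψ (Fin.snoc (α := fun _ => Fin k × ℝ) (History.own p h) (a, r))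
            ∂(D.reward a) ∂((F p).choice t h) ∂(historyLaw D F t) := hstep D ψ hψ
      _ ≤ ∫⁻ h, Ψ (History.own p h) ∂(historyLaw D F t) := by
          refine lintegral_mono fun h => ?_
          simp only [hκ h, Ψ]
          exact lintegral_mono fun a => hc a _
      _ ≤ ∫⁻ h, c ^ pullCount i (History.own p h) * Ψ (History.own p h) ∂(historyLaw D' F t) :=
          ih Ψ hΨ
      _ = ∫⁻ h, c ^ pullCount i (History.own p h) * ψ (History.own p h)
            ∂(historyLaw D' F (t + 1)) := by
          rw [hstep D' (fun y => c ^ pullCount i y * ψ y)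
            (((measurable_of_countable fun m : ℕ => c ^ m).comp (measurable_pullCount i)).mul hψ)]
          refine lintegral_congr fun h => ?_
          simp only [hκ h, Ψ]
          have hm : ∀ a : Fin k, Measurable fun r : ℝ =>
              ψ (Fin.snoc (α := fun _ => Fin k × ℝ) (History.own p h) (a, r)) := fun a =>
            hψ.comp (measurable_snoc_own.comp (by fun_prop :
              Measurable fun r : ℝ => (History.own p h, (a, r))))
          refine (lintegral_const_mul _ (measurable_of_finite _)).symm.trans ?_
          refine lintegral_congr fun a => ?_
          simp only [pullCount_snoc, pow_add, mul_assoc]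
          exact ((lintegral_const_mul _ ((hm a).const_mul _)).trans
            (congrArg _ (lintegral_const_mul _ (hm a)))).symm

/-! ### Expected rewards and regret in terms of pull counts -/

/-- Given its arm, a reward is a fresh draw from that arm's law. The last round shows this directly
from the round kernel; earlier rounds are unaffected by appending another. -/
theorem lintegral_round_eq (D : StochasticBandit k) (F : Fin n → Policy n k) (p : Fin n)
    {φ : Fin k × ℝ → ℝ≥0∞} (hφ : Measurable φ) (T : ℕ) :
    ∀ t : Fin T, ∫⁻ h, φ (h t p) ∂(historyLaw D F T) =
      ∫⁻ h, ∫⁻ r, φ ((h t p).1, r) ∂(D.reward (h t p).1) ∂(historyLaw D F T) := by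
  have hm : ∀ {T : ℕ} (t : Fin T), Measurable fun h : History n k T => h t p := fun t =>
    (measurable_pi_apply p).comp (measurable_pi_apply t)
  have hinner : Measurable fun z : Fin k × ℝ => ∫⁻ r, φ (z.1, r) ∂(D.reward z.1) :=
    (measurable_of_finite fun a : Fin k => ∫⁻ r, φ (a, r) ∂(D.reward a)).comp measurable_fst
  induction T with
  | zero => exact fun t => t.elim0
  | succ T ih =>
    intro t
    refine (lintegral_historyLaw_succ D F T (hφ.comp (hm t))).trans
      (Eq.trans ?_ (lintegral_historyLaw_succ D F T (hinner.comp (hm t))).symm)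
    simp only [Function.comp_apply]
    refine Fin.lastCases ?_ (fun s => ?_) t
    · refine lintegral_congr fun h => ?_
      simp only [History.extend, Fin.snoc_last]
      rw [lintegral_roundKernel_apply D F p h hφ, lintegral_roundKernel_apply D F p h hinner]
      have (a : Fin k) : IsProbabilityMeasure (D.reward a) := D.isProb a
      simp
    · simpa [History.extend] using ih s

theorem map_round_eq (D : StochasticBandit k) (F : Fin n → Policy n k) (p : Fin n) {T : ℕ}
    (t : Fin T) : (historyLaw D F T).map (fun h => h t p) =
      ((historyLaw D F T).map fun h => (h t p).1) ⊗ₘ D.rewardKernel := by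
  have hm : Measurable fun h : History n k T => h t p :=
    (measurable_pi_apply p).comp (measurable_pi_apply t)
  refine Measure.ext_of_lintegral _ fun φ hφ => ?_
  have : IsProbabilityMeasure ((historyLaw D F T).map fun h => (h t p).1) :=
    Measure.isProbabilityMeasure_map hm.fst.aemeasurable
  rw [lintegral_map hφ hm, lintegral_round_eq D F p hφ T t, Measure.lintegral_compProd hφ,
    lintegral_map (measurable_of_finite _) hm.fst]
  rfl

theorem integral_reward_eq (D : StochasticBandit k) (F : Fin n → Policy n k) (p : Fin n) {T : ℕ}
    (t : Fin T) : ∫ h, (h t p).2 ∂(historyLaw D F T) =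
      ∫ h, D.mean (h t p).1 ∂(historyLaw D F T) := by
  have hm : Measurable fun h : History n k T => h t p :=
    (measurable_pi_apply p).comp (measurable_pi_apply t)
  have : IsProbabilityMeasure ((historyLaw D F T).map fun h => (h t p).1) :=
    Measure.isProbabilityMeasure_map hm.fst.aemeasurable
  have hint : Integrable (fun z : Fin k × ℝ => z.2)
      (((historyLaw D F T).map fun h => (h t p).1) ⊗ₘ D.rewardKernel) := by
    refine Integrable.of_bound measurable_snd.aestronglyMeasurable 1 ?_
    refine (Measure.ae_compProd_iff (measurableSet_le (by fun_prop) (by fun_prop))).2 ?_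
    refine Eventually.of_forall fun a => ?_
    filter_upwards [D.support a] with r hr
    exact abs_le.2 hr
  rw [← integral_map (f := fun z : Fin k × ℝ => z.2) hm.aemeasurable
    measurable_snd.aestronglyMeasurable, map_round_eq, Measure.integral_compProd hint,
    integral_map hm.fst.aemeasurable (measurable_of_finite _).aestronglyMeasurable]
  rfl

theorem measurable_sampleCount {T : ℕ} (p : Fin n) (i : Fin k) :
    Measurable fun h : History n k T => sampleCount h p i :=
  (measurable_pullCount i).comp (History.measurable_own p)

theorem sampleCount_le {T : ℕ} (h : History n k T) (p : Fin n) (i : Fin k) :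
    sampleCount h p i ≤ T := by
  simpa [sampleCount] using Finset.card_filter_le Finset.univ fun t : Fin T => (h t p).1 = i

theorem integrable_sampleCount (D : StochasticBandit k) (F : Fin n → Policy n k) (p : Fin n)
    (i : Fin k) (T : ℕ) :
    Integrable (fun h => (sampleCount h p i : ℝ)) (historyLaw D F T) := by
  refine Integrable.of_bound
    ((measurable_of_countable _).comp (measurable_sampleCount p i)).aestronglyMeasurable T ?_
  refine Eventually.of_forall fun h => ?_
  simpa using sampleCount_le h p i

/-- A gap `Δ` between arm `i` and all other arms bounds the regret from below. -/
theorem gap_mul_le_regret (D : StochasticBandit k) (F : Fin n → Policy n k) (p : Fin n)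
    {i : Fin k} {Δ : ℝ} (hΔ : ∀ j, j ≠ i → D.mean j + Δ ≤ D.mean i) (T : ℕ) :
    Δ * (T - expectedSampleCount D F p i T) ≤ regret D F p T := by
  have hm : ∀ t : Fin T, Measurable fun h : History n k T => h t p := fun t =>
    (measurable_pi_apply p).comp (measurable_pi_apply t)
  have hmean : ∀ t : Fin T, Integrable (fun h => D.mean (h t p).1) (historyLaw D F T) := by
    intro t
    have : IsProbabilityMeasure ((historyLaw D F T).map fun h => (h t p).1) :=
      Measure.isProbabilityMeasure_map (hm t).fst.aemeasurable
    have hfin : Integrable D.mean ((historyLaw D F T).map fun h => (h t p).1) :=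
      Integrable.of_finite
    exact hfin.comp_measurable (hm t).fst
  have hsub : Integrable (fun h => (T : ℝ) - sampleCount h p i) (historyLaw D F T) :=
    (integrable_const _).sub (integrable_sampleCount D F p i T)
  have hsum : ∑ t : Fin T, ∫ h, (h t p).2 ∂(historyLaw D F T) ≤
      ∫ h, (T * D.mean i - Δ * (T - sampleCount h p i)) ∂(historyLaw D F T) := by
    simp only [integral_reward_eq]
    rw [← integral_finsetSum _ fun t _ => hmean t]
    refine integral_mono (integrable_finsetSum _ fun t _ => hmean t) ?_ fun h => ?_
    · exact (integrable_const _).sub (hsub.const_mul Δ)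
    · have hcount : (sampleCount h p i : ℝ) = ∑ t : Fin T, if (h t p).1 = i then (1 : ℝ) else 0 := by
        simp [sampleCount]
      have hrhs : (T : ℝ) * D.mean i - Δ * (T - sampleCount h p i) =
          ∑ t : Fin T, (D.mean i - Δ * (1 - if (h t p).1 = i then (1 : ℝ) else 0)) := by
        rw [Finset.sum_sub_distrib, ← Finset.mul_sum, Finset.sum_sub_distrib, hcount]
        simp
      simp only [hrhs]
      refine Finset.sum_le_sum fun t _ => ?_
      by_cases hi : (h t p).1 = i
      · simp [hi]
      · have := hΔ _ hi
        simp only [hi, if_false]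
        linarith
  have hval : ∫ h, (T * D.mean i - Δ * (T - sampleCount h p i)) ∂(historyLaw D F T) =
      T * D.mean i - Δ * (T - expectedSampleCount D F p i T) := by
    rw [integral_sub (integrable_const _) (hsub.const_mul Δ),
      integral_const_mul Δ, integral_sub (integrable_const _) (integrable_sampleCount D F p i T)]
    simp [expectedSampleCount]
  have := mul_le_mul_of_nonneg_left (D.mean_le_bestMean i) (Nat.cast_nonneg (α := ℝ) T)
  rw [regret]
  linarith [hsum.trans hval.le]

/-! ### Markov inequalities and comparison of probabilities -/

/-- Markov's inequality for the nonnegative number `T - N` of pulls of the other arms. -/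
theorem sub_mul_measureReal_le (D : StochasticBandit k) (F : Fin n → Policy n k) (p : Fin n)
    (i : Fin k) (T : ℕ) (m : ℝ) :
    (T - m) * (historyLaw D F T).real {h | (sampleCount h p i : ℝ) ≤ m} ≤
      T - expectedSampleCount D F p i T := by
  have hmk := mul_meas_ge_le_integral_of_nonneg (μ := historyLaw D F T)
    (f := fun h => (T : ℝ) - sampleCount h p i)
    (Eventually.of_forall fun h => sub_nonneg.2 (Nat.cast_le.2 (sampleCount_le h p i)))
    ((integrable_const _).sub (integrable_sampleCount D F p i T)) (T - m)
  rw [integral_sub (integrable_const _) (integrable_sampleCount D F p i T)] at hmk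
  simp only [sub_le_sub_iff_left] at hmk
  simpa [expectedSampleCount] using hmk

/-- Markov's inequality for `N`, as the complement of `N ≤ m` lies in `N ≥ m`. -/
theorem mul_one_sub_measureReal_le (D : StochasticBandit k) (F : Fin n → Policy n k) (p : Fin n)
    (i : Fin k) (T : ℕ) {m : ℝ} (hm : 0 ≤ m) :
    m * (1 - (historyLaw D F T).real {h | (sampleCount h p i : ℝ) ≤ m}) ≤
      expectedSampleCount D F p i T := by
  have hmk := mul_meas_ge_le_integral_of_nonneg (μ := historyLaw D F T)
    (f := fun h => (sampleCount h p i : ℝ))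
    (Eventually.of_forall fun h => Nat.cast_nonneg _) (integrable_sampleCount D F p i T) m
  refine le_trans (mul_le_mul_of_nonneg_left ?_ hm) hmk
  have hmeas : MeasurableSet {h : History n k T | (sampleCount h p i : ℝ) ≤ m} :=
    measurableSet_le ((measurable_of_countable _).comp (measurable_sampleCount p i))
      measurable_const
  rw [← probReal_compl_eq_one_sub hmeas]
  refine measureReal_mono fun h hh => ?_
  have hlt : m < sampleCount h p i := by simpa using hh
  exact hlt.le

/-- Events of few pulls of arm `i` have comparable probabilities under `D` and `D'`. -/
theorem measureReal_sampleCount_le {D D' : StochasticBandit k} (F : Fin n → Policy n k)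
    {p : Fin n} (hself : (F p).SelfReliant p) {i : Fin k} {c : ℝ} (hc1 : 1 ≤ c)
    (hc : ∀ (a : Fin k) (f : ℝ → ℝ≥0∞), ∫⁻ r, f r ∂(D.reward a) ≤
      ENNReal.ofReal c ^ (if a = i then 1 else 0) * ∫⁻ r, f r ∂(D'.reward a))
    (T : ℕ) (m : ℝ) :
    (historyLaw D F T).real {h | (sampleCount h p i : ℝ) ≤ m} ≤
      c ^ m * (historyLaw D' F T).real {h | (sampleCount h p i : ℝ) ≤ m} := by
  have hc0 : 0 < c := zero_lt_one.trans_le hc1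
  let A : Set (Fin T → Fin k × ℝ) := {y | (pullCount i y : ℝ) ≤ m}
  have hA : MeasurableSet A :=
    measurableSet_le ((measurable_of_countable _).comp (measurable_pullCount i)) measurable_const
  have hpre : {h : History n k T | (sampleCount h p i : ℝ) ≤ m} = History.own p ⁻¹' A := rfl
  have hApre : MeasurableSet (History.own p ⁻¹' A : Set (History n k T)) :=
    History.measurable_own p hA
  have key := lintegral_own_le_of_selfReliant F hself hc T (A.indicator 1)
    (measurable_one.indicator hA)
  have hmain : historyLaw D F T (History.own p ⁻¹' A) ≤
      ENNReal.ofReal (c ^ m) * historyLaw D' F T (History.own p ⁻¹' A) := by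
    rw [← lintegral_indicator_one hApre, ← lintegral_indicator_one hApre,
      ← lintegral_const_mul _ (measurable_one.indicator hApre)]
    refine key.trans (lintegral_mono fun h => ?_)
    by_cases hh : History.own p h ∈ A
    · have h1 : h ∈ (History.own p ⁻¹' A : Set (History n k T)) := hh
      simp only [Set.indicator_of_mem hh, Set.indicator_of_mem h1, Pi.one_apply, mul_one]
      rw [← ENNReal.ofReal_pow hc0.le, ← Real.rpow_natCast]
      exact ENNReal.ofReal_le_ofReal (Real.rpow_le_rpow_of_exponent_le hc1 hh)
    · simp [Set.indicator_of_notMem hh]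
  rw [hpre, measureReal_def, measureReal_def,
    ← ENNReal.toReal_ofReal (Real.rpow_nonneg hc0.le m), ← ENNReal.toReal_mul]
  exact ENNReal.toReal_mono (ENNReal.mul_ne_top ENNReal.ofReal_ne_top (measure_ne_top _ _)) hmain

end Play

/-! ### The bandit in which arm `i` is boosted to be best -/

namespace StochasticBandit

variable {k : ℕ}

theorem integrable_id_reward (D : StochasticBandit k) (i : Fin k) :
    Integrable (fun x : ℝ => x) (D.reward i) := by
  have := D.isProb i
  refine Integrable.of_bound measurable_id.aestronglyMeasurable 1 ?_
  filter_upwards [D.support i] with x hx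
  exact abs_le.2 hx

theorem neg_one_le_mean (D : StochasticBandit k) (i : Fin k) : -1 ≤ D.mean i := by
  have := D.isProb i
  have h := integral_mono_ae (μ := D.reward i) (integrable_const (-1 : ℝ))
    (D.integrable_id_reward i) ((D.support i).mono fun x hx => hx.1)
  simpa [mean] using h

/-- If the best mean is below `1`, then arm `i` can be made the unique best arm while its
reward distribution changes by at most a bounded factor. -/
theorem exists_boost (D : StochasticBandit k) (hD : D.bestMean < 1) (i : Fin k) :
    ∃ (D' : StochasticBandit k) (c Δ : ℝ), 1 < c ∧ 0 < Δ ∧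
      (∀ j, j ≠ i → D'.mean j + Δ ≤ D'.mean i) ∧
      ∀ (a : Fin k) (f : ℝ → ℝ≥0∞), ∫⁻ r, f r ∂(D.reward a) ≤
        ENNReal.ofReal c ^ (if a = i then 1 else 0) * ∫⁻ r, f r ∂(D'.reward a) := by
  have := D.isProb i
  have hlow : -1 ≤ D.bestMean := (D.neg_one_le_mean i).trans (D.mean_le_bestMean i)
  -- As `μ_i ≥ -1`, the mixture below has mean at least `1 - 2q`, which for this `q` equals `μ* +
  -- 2q`; hence the gap `2 * q`.
  set q : ℝ := (1 - D.bestMean) / 4 with hq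
  have hq0 : 0 < q := by linarith
  have hq1 : q ≤ 1 / 2 := by linarith
  let ν : Measure ℝ := ENNReal.ofReal q • D.reward i + ENNReal.ofReal (1 - q) • Measure.dirac 1
  have hν : ∫ x, x ∂ν = q * D.mean i + (1 - q) := by
    rw [integral_add_measure ((D.integrable_id_reward i).smul_measure ENNReal.ofReal_ne_top)
      ((integrable_dirac (by simp)).smul_measure ENNReal.ofReal_ne_top), integral_smul_measure,
      integral_smul_measure, integral_dirac, ENNReal.toReal_ofReal hq0.le,
      ENNReal.toReal_ofReal (by linarith)]
    simp [mean]
  have hνmean : D.bestMean + 2 * q ≤ ∫ x, x ∂ν := by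
    rw [hν]
    nlinarith [D.neg_one_le_mean i]
  have hother : ∀ j, j ≠ i → ∫ x, x ∂(Function.update D.reward i ν j) + 2 * q ≤
      ∫ x, x ∂(Function.update D.reward i ν i) := by
    intro j hj
    rw [Function.update_of_ne hj, Function.update_self]
    have h := D.mean_le_bestMean j
    rw [mean] at h
    linarith
  let D' : StochasticBandit k :=
    { reward := Function.update D.reward i ν
      isProb := fun j => by
        by_cases hj : j = i
        · subst hj
          rw [Function.update_self]
          refine ⟨?_⟩
          simp only [ν, Measure.add_apply, Measure.smul_apply, measure_univ, smul_eq_mul, mul_one]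
          rw [← ENNReal.ofReal_add hq0.le (by linarith)]
          simp
        · rw [Function.update_of_ne hj]
          exact D.isProb j
      support := fun j => by
        by_cases hj : j = i
        · subst hj
          rw [Function.update_self, ae_add_measure_iff]
          refine ⟨Measure.ae_smul_measure (D.support j) _, Measure.ae_smul_measure ?_ _⟩
          refine (ae_dirac_iff measurableSet_Icc).2 ?_
          norm_num
        · rw [Function.update_of_ne hj]
          exact D.support j
      unique_best := ⟨i, fun j hj => by linarith [hother j hj]⟩ }
  -- The factor is `q⁻¹` because `ν` dominates `q` times the old law of arm `i`.
  refine ⟨D', q⁻¹, 2 * q, (one_lt_inv₀ hq0).2 (by linarith), by linarith, hother, fun a f => ?_⟩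
  by_cases ha : a = i
  · subst ha
    have hD' : D'.reward a = ν := Function.update_self ..
    rw [hD', if_pos rfl, pow_one, lintegral_add_measure, lintegral_smul_measure, mul_add,
      smul_eq_mul, ← mul_assoc, ← ENNReal.ofReal_mul (inv_nonneg.2 hq0.le),
      inv_mul_cancel₀ hq0.ne', ENNReal.ofReal_one, one_mul]
    exact le_self_add
  · have hD' : D'.reward a = D.reward a := Function.update_of_ne ha ..
    simp [hD', ha]

end StochasticBandit

/-! ### The logarithmic lower bound -/

theorem theorem1 {n k : ℕ} (F : Fin n → Policy n k) (p : Fin n)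
    (hself : (F p).SelfReliant p)
    (ε : ℝ) (hε : 0 < ε)
    (hregret : ∀ D : StochasticBandit k,
      (fun T : ℕ => regret D F p T) =O[atTop] (fun T : ℕ => (T : ℝ) ^ (1 - ε)))
    (D : StochasticBandit k) (hD : D.bestMean < 1) (i : Fin k) :
    (fun T : ℕ => Real.log (T : ℝ)) =O[atTop] (fun T : ℕ => expectedSampleCount D F p i T) := by
  obtain ⟨D', c, Δ, hc1, hΔ, hgap, hc⟩ := D.exists_boost hD i
  obtain ⟨C, hC0, hC⟩ := (hregret D').exists_pos
  have hlogc : 0 < Real.log c := Real.log_pos hc1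
  -- Chosen so that `c ^ (a * log T) = T ^ (ε / 2)`: the change of measure spends only half of the
  -- decay `T ^ (-ε)`.
  set a : ℝ := ε / 2 / Real.log c with ha
  have ha0 : 0 < a := by positivity
  have hlogT : Tendsto (fun T : ℕ => a * Real.log T / T) atTop (nhds 0) := by
    have h := (Real.isLittleO_log_id_atTop.tendsto_div_nhds_zero.comp
      tendsto_natCast_atTop_atTop).const_mul a
    simpa [Function.comp_def, mul_div_assoc] using h
  have hpow : Tendsto (fun T : ℕ => 2 * C / Δ * (T : ℝ) ^ (-(ε / 2))) atTop (nhds 0) := by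
    have h := ((tendsto_rpow_neg_atTop (half_pos hε)).comp
      tendsto_natCast_atTop_atTop).const_mul (2 * C / Δ)
    simpa [Function.comp_def] using h
  refine IsBigO.of_bound (2 / a) ?_
  filter_upwards [hC.bound, hlogT.eventually_le_const (show (0 : ℝ) < 1 / 2 by norm_num),
    hpow.eventually_le_const (show (0 : ℝ) < 1 / 2 by norm_num), eventually_ge_atTop 1]
    with T hreg hlog hpw hT
  have hT0 : (0 : ℝ) < T := by exact_mod_cast hT
  have hlog0 : 0 ≤ Real.log T := Real.log_nonneg (by exact_mod_cast hT)
  set m : ℝ := a * Real.log T with hm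
  have hm0 : 0 ≤ m := by positivity
  have hmT : (T : ℝ) / 2 ≤ T - m := by
    rw [div_le_iff₀ hT0] at hlog
    linarith
  have hcm : c ^ m = (T : ℝ) ^ (ε / 2) := by
    rw [Real.rpow_def_of_pos (zero_lt_one.trans hc1), Real.rpow_def_of_pos hT0, hm, ha]
    congr 1
    field_simp
  set P := (historyLaw D F T).real {h | (sampleCount h p i : ℝ) ≤ m}
  set P' := (historyLaw D' F T).real {h | (sampleCount h p i : ℝ) ≤ m}
  have hP'0 : 0 ≤ P' := measureReal_nonneg
  -- Few pulls of `i` leave at least `T / 2` pulls of arms that are worse by `Δ` under `D'`, so the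
  -- regret bound makes this event rare.
  have hP' : P' ≤ 2 * C / Δ * (T : ℝ) ^ (-ε) := by
    have h1 : (T : ℝ) / 2 * P' ≤ T - expectedSampleCount D' F p i T :=
      (mul_le_mul_of_nonneg_right hmT hP'0).trans (sub_mul_measureReal_le D' F p i T m)
    have h2 : Δ * ((T : ℝ) / 2 * P') ≤ C * ((T : ℝ) * (T : ℝ) ^ (-ε)) := by
      calc Δ * ((T : ℝ) / 2 * P') ≤ regret D' F p T :=
            (mul_le_mul_of_nonneg_left h1 hΔ.le).trans (gap_mul_le_regret D' F p hgap T)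
        _ ≤ C * (T : ℝ) ^ (1 - ε) := by
            refine (le_abs_self _).trans ?_
            simpa [Real.norm_eq_abs, abs_of_nonneg (Real.rpow_nonneg hT0.le _)] using hreg
        _ = C * ((T : ℝ) * (T : ℝ) ^ (-ε)) := by
            rw [sub_eq_add_neg, Real.rpow_add hT0, Real.rpow_one]
    have h3 : P' = 2 / (Δ * T) * (Δ * ((T : ℝ) / 2 * P')) := by field_simp
    rw [h3]
    refine (mul_le_mul_of_nonneg_left h2 (by positivity)).trans_eq ?_
    field_simp
  have hP : P ≤ 1 / 2 := by
    calc P ≤ c ^ m * P' := measureReal_sampleCount_le F hself hc1.le hc T m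
      _ ≤ (T : ℝ) ^ (ε / 2) * (2 * C / Δ * (T : ℝ) ^ (-ε)) := by
          rw [hcm]
          exact mul_le_mul_of_nonneg_left hP' (Real.rpow_nonneg hT0.le _)
      _ = 2 * C / Δ * (T : ℝ) ^ (-(ε / 2)) := by
          rw [mul_left_comm, ← Real.rpow_add hT0]
          congr 2
          ring
      _ ≤ 1 / 2 := hpw
  have hE : m * (1 / 2) ≤ expectedSampleCount D F p i T :=
    (mul_le_mul_of_nonneg_left (by linarith) hm0).trans (mul_one_sub_measureReal_le D F p i T hm0)
  rw [Real.norm_of_nonneg hlog0, Real.norm_of_nonneg (le_trans (by positivity) hE)]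
  calc Real.log T = 2 / a * (m * (1 / 2)) := by rw [hm]; field_simp
    _ ≤ 2 / a * expectedSampleCount D F p i T := by gcongr
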